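/- \textbf{Proposition.} Let $\mathbb{P}_p$ denote Bernoulli bond percolation on the square lattice $\mathbb{Z}^2$: each edge (pair of vertices at Euclidean distance $1$) is open with probability $p$ and closed with probability $1-p$, independently of all other edges. For integers $a,b\ge 0$, let $R(a,b):=[0,a]\times[0,b]$ (width $a$, height $b$), and let $\mathcal{H}(a,b)$ be the event that $R(a,b)$ is crossed horizontally, i.e. that there is a path of open edges of $\mathbb{Z}^2$, all of whose vertices lie in $R(a,b)$, from the left side $\{0\}\times[0,b]$ to the right side $\{a\}\times[0,b]$. Then, for every integer $n\ge 1$, $$\mathbb{P}_{1/2}\big[\mathcal{H}(n,n-1)\big]=\tfrac12 .$$ -/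

import Mathlib

open MeasureTheory ProbabilityTheory

namespace SquarePercolation

/-- The square lattice `ℤ²`: two vertices are adjacent when they are at Euclidean distance `1`,
that is (for integer coordinates) when `|x₁ - y₁| + |x₂ - y₂| = 1`. -/
def squareLattice : SimpleGraph (ℤ × ℤ) where
  Adj x y := |x.1 - y.1| + |x.2 - y.2| = 1
  symm := ⟨fun x y h => by rw [abs_sub_comm y.1, abs_sub_comm y.2]; exact h⟩
  loopless := ⟨fun x h => by simp at h⟩

/-- A percolation configuration: each edge of `ℤ²` is open (`true`) or closed (`false`). -/
abbrev Config : Type := squareLattice.edgeSet → Bool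

/-- Bernoulli bond percolation on `ℤ²` with parameter `p`: the edges are independently open with
probability `p` and closed with probability `1 - p`. -/
noncomputable def bernoulliPercolation (p : unitInterval) : Measure Config :=
  Measure.infinitePi fun _ => bernoulliMeasure true false p

/-- The graph on `ℤ²` formed by the open edges of `ω`. -/
def openGraph (ω : Config) : SimpleGraph (ℤ × ℤ) where
  Adj x y := ∃ h : squareLattice.Adj x y, ω ⟨s(x, y), h⟩ = true
  symm := ⟨fun x y ⟨h, hω⟩ => ⟨h.symm, by
    have e : (⟨s(y, x), h.symm⟩ : squareLattice.edgeSet) = ⟨s(x, y), h⟩ :=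
      Subtype.ext Sym2.eq_swap
    rw [e]; exact hω⟩⟩
  loopless := ⟨fun x ⟨h, _⟩ => squareLattice.loopless.irrefl x h⟩

/-- The vertices of the rectangle `R(a, b) = [0, a] × [0, b]`, of width `a` and height `b`. -/
def rect (a b : ℤ) : Set (ℤ × ℤ) := Set.Icc 0 a ×ˢ Set.Icc 0 b

/-- `H(a, b)`: the rectangle `R(a, b)` is crossed horizontally, i.e. there is a path of open edges
inside `R(a, b)` from its left side `{0} × [0, b]` to its right side `{a} × [0, b]`. -/
def horizontalCrossing (a b : ℤ) : Set Config :=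
  {ω | ∃ (x y : ℤ × ℤ) (w : (openGraph ω).Walk x y),
    x.1 = 0 ∧ y.1 = a ∧ ∀ v ∈ w.support, v ∈ rect a b}

end SquarePercolation

namespace SquarePercolation

/-! ### Edges of the square lattice and the duality map -/

/-! The proof is planar self-duality. The point `(a, b)` of the reflected dual stands for the face
centred at `(b + 1/2, a - 1/2)`, so a horizontal crossing in `dualConfig ω` is a path of faces from
bottom to top of the rectangle that traverses only closed edges. Exactly one of `ω` and `dualConfig
ω` has a crossing. Both cannot (`dualConfig_notMem_horizontalCrossing`), by an intersection-number
argument. One must (`dualConfig_mem_horizontalCrossing`), by summation by parts on cluster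
indicators, which avoids tracing an interface. At `p = 1/2` the map `dualConfig` preserves the
measure, so the event and its complement are equally likely. -/

/-- The edge from `p` to its right neighbour (`false`) or to its upper neighbour (`true`). -/
def edgeOf : (ℤ × ℤ) × Bool → squareLattice.edgeSet
  | (p, false) => ⟨s(p, (p.1 + 1, p.2)), by simp [squareLattice]⟩
  | (p, true) => ⟨s(p, (p.1, p.2 + 1)), by simp [squareLattice]⟩

lemma adj_cases {u v : ℤ × ℤ} (h : squareLattice.Adj u v) :
    v = (u.1 + 1, u.2) ∨ u = (v.1 + 1, v.2) ∨ v = (u.1, u.2 + 1) ∨ u = (v.1, v.2 + 1) := by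
  obtain ⟨a, b⟩ := u
  obtain ⟨c, d⟩ := v
  simp only [squareLattice, Prod.mk.injEq] at h ⊢
  grind

lemma edgeOf_bijective : Function.Bijective edgeOf := by
  constructor
  · rintro ⟨⟨a, b⟩, _ | _⟩ ⟨⟨c, d⟩, _ | _⟩ h <;>
      simp [edgeOf, Subtype.ext_iff] at h ⊢ <;> omega
  · rintro ⟨e, he⟩
    induction e using Sym2.ind with
    | _ u v =>
      have hadj : squareLattice.Adj u v := he
      rcases adj_cases hadj with h | h | h | h
      · exact ⟨(u, false), Subtype.ext (by simp [edgeOf, h])⟩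
      · exact ⟨(v, false), Subtype.ext (by simp [edgeOf, h])⟩
      · exact ⟨(u, true), Subtype.ext (by simp [edgeOf, h])⟩
      · exact ⟨(v, true), Subtype.ext (by simp [edgeOf, h])⟩

/-- The edges of `ℤ²`, indexed by their lower left end and their direction. -/
noncomputable def edgeEquiv : (ℤ × ℤ) × Bool ≃ squareLattice.edgeSet :=
  Equiv.ofBijective edgeOf edgeOf_bijective

/-- Planar duality followed by the reflection that takes the dual rectangle of `R(n, n - 1)` to
`R(n, n - 1)`, on the indices of edges. -/
def dualIndex : (ℤ × ℤ) × Bool → (ℤ × ℤ) × Bool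
  | ((a, b), false) => ((b, a), false)
  | ((a, b), true) => ((b + 1, a - 1), true)

lemma dualIndex_injective : Function.Injective dualIndex := by
  rintro ⟨⟨a, b⟩, _ | _⟩ ⟨⟨c, d⟩, _ | _⟩ h <;> simp [dualIndex] at h ⊢ <;> omega

/-- The edge of `ℤ²` crossed by the reflected dual edge `e`. -/
noncomputable def dualEdge (e : squareLattice.edgeSet) : squareLattice.edgeSet :=
  edgeOf (dualIndex (edgeEquiv.symm e))

lemma dualEdge_injective : Function.Injective dualEdge :=
  edgeOf_bijective.1.comp (dualIndex_injective.comp edgeEquiv.symm.injective)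

lemma dualEdge_edgeOf (i : (ℤ × ℤ) × Bool) : dualEdge (edgeOf i) = edgeOf (dualIndex i) := by
  unfold dualEdge
  congr 2
  exact edgeEquiv.symm_apply_apply i

/-- The (reflected) dual configuration: a dual edge is open when the edge it crosses is closed. -/
noncomputable def dualConfig (ω : Config) : Config := fun e => !ω (dualEdge e)

/-- The edge with index `i` is open in `ω`. -/
def IsOpenAt (ω : Config) (i : (ℤ × ℤ) × Bool) : Prop := ω (edgeOf i) = true

lemma isOpenAt_dualConfig_horizontal (ω : Config) (a b : ℤ) :
    IsOpenAt (dualConfig ω) ((a, b), false) ↔ ¬ IsOpenAt ω ((b, a), false) := by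
  simp [IsOpenAt, dualConfig, dualEdge_edgeOf, dualIndex]

lemma isOpenAt_dualConfig_vertical (ω : Config) (a b : ℤ) :
    IsOpenAt (dualConfig ω) ((a, b), true) ↔ ¬ IsOpenAt ω ((b + 1, a - 1), true) := by
  simp [IsOpenAt, dualConfig, dualEdge_edgeOf, dualIndex]

lemma openGraph_adj_right {ω : Config} {a b : ℤ} (h : IsOpenAt ω ((a, b), false)) :
    (openGraph ω).Adj (a, b) (a + 1, b) :=
  ⟨(edgeOf ((a, b), false)).2, h⟩

lemma openGraph_adj_up {ω : Config} {a b : ℤ} (h : IsOpenAt ω ((a, b), true)) :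
    (openGraph ω).Adj (a, b) (a, b + 1) :=
  ⟨(edgeOf ((a, b), true)).2, h⟩

lemma openGraph_adj_cases {ω : Config} {u v : ℤ × ℤ} (h : (openGraph ω).Adj u v) :
    (v = (u.1 + 1, u.2) ∧ IsOpenAt ω (u, false)) ∨ (u = (v.1 + 1, v.2) ∧ IsOpenAt ω (v, false)) ∨
    (v = (u.1, u.2 + 1) ∧ IsOpenAt ω (u, true)) ∨ (u = (v.1, v.2 + 1) ∧ IsOpenAt ω (v, true)) := by
  have key : ∀ {u v : ℤ × ℤ} (i), (openGraph ω).Adj u v → (edgeOf i).1 = s(u, v) →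
      IsOpenAt ω i := by
    rintro u v i ⟨h, hω⟩ hi
    rw [IsOpenAt, ← hω]
    exact congrArg ω (Subtype.ext hi)
  rcases adj_cases h.1 with e | e | e | e
  · exact .inl ⟨e, key _ h (by simp [edgeOf, e])⟩
  · exact .inr (.inl ⟨e, key _ h.symm (by simp [edgeOf, e])⟩)
  · exact .inr (.inr (.inl ⟨e, key _ h (by simp [edgeOf, e])⟩))
  · exact .inr (.inr (.inr ⟨e, key _ h.symm (by simp [edgeOf, e])⟩))

/-! ### Sums along walks -/

/-- The sum of `φ` over the steps of a walk. -/
def stepSum {V : Type*} {G : SimpleGraph V} (φ : V → V → ℤ) : ∀ {x y : V}, G.Walk x y → ℤ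
  | _, _, .nil => 0
  | _, _, .cons (u := u) (v := v) _ p => φ u v + stepSum φ p

lemma stepSum_eq_add_sub {V : Type*} {G : SimpleGraph V} {φ ψ : V → V → ℤ} (f : V → ℤ)
    {x y : V} (w : G.Walk x y)
    (h : ∀ u ∈ w.support, ∀ v ∈ w.support, G.Adj u v → φ u v = ψ u v + (f v - f u)) :
    stepSum φ w = stepSum ψ w + (f y - f x) := by
  induction w with
  | nil => simp [stepSum]
  | cons e p ih =>
    rw [stepSum, stepSum, ih fun u hu v hv => h u (by simp [hu]) v (by simp [hv]),
      h _ (by simp) _ (by simp) e]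
    ring

lemma stepSum_zero {V : Type*} {G : SimpleGraph V} {x y : V} (w : G.Walk x y) :
    stepSum (fun _ _ => 0) w = 0 := by
  induction w with
  | nil => rfl
  | cons e p ih => simp [stepSum, ih]

lemma eq_of_walk {V α : Type*} {G : SimpleGraph V} (g : V → α) {x y : V} (w : G.Walk x y)
    (h : ∀ u ∈ w.support, ∀ v ∈ w.support, G.Adj u v → g u = g v) : g x = g y := by
  induction w with
  | nil => rfl
  | cons e p ih =>
    exact (h _ (by simp) _ (by simp) e).trans
      (ih fun u hu v hv => h u (by simp [hu]) v (by simp [hv]))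

/-! ### A crossing and a dual crossing exclude each other -/

/-- The signed indicator of the steps along the horizontal edges from column `i` to column `i + 1`
that lie below height `j`. -/
def columnFlux (i j : ℤ) (u v : ℤ × ℤ) : ℤ :=
  if u.1 = i ∧ v.1 = i + 1 ∧ u.2 < j then 1 else if v.1 = i ∧ u.1 = i + 1 ∧ u.2 < j then -1 else 0

/-- The sum of `columnFlux b a` is the net number of passages of the crossing through the ray going
down from the face `(b + 1/2, a - 1/2)`. It stays constant as the face moves along the dual path,
yet it is 0 at the bottom and 1 at the top. -/
lemma dualConfig_notMem_horizontalCrossing {n : ℤ} {ω : Config}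
    (hω : ω ∈ horizontalCrossing n (n - 1)) : dualConfig ω ∉ horizontalCrossing n (n - 1) := by
  obtain ⟨x, y, w, hx, hy, hw⟩ := hω
  rintro ⟨x', y', w', hx', hy', hw'⟩
  simp only [rect, Set.mem_prod, Set.mem_Icc] at hw hw'
  have hsx := hw' _ w'.start_mem_support
  have hsy := hw' _ w'.end_mem_support
  have h0 : ∀ b, stepSum (columnFlux b 0) w = 0 := fun b => by
    rw [stepSum_eq_add_sub (ψ := fun _ _ => 0) (fun _ => 0) w, stepSum_zero]
    · simp
    · intro u hu v hv _
      have := hw u hu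
      simp only [columnFlux]
      grind
  have h1 : ∀ b, 0 ≤ b → b < n → stepSum (columnFlux b n) w = 1 := fun b hb hbn => by
    -- All of `w` lies below height `n`, so the flux is the gradient of the indicator of the columns
    -- beyond `b`.
    rw [stepSum_eq_add_sub (ψ := fun _ _ => 0) (fun u => if u.1 ≤ b then 0 else 1) w, stepSum_zero]
    · grind
    · intro u hu v hv huv
      have := hw u hu
      have := hw v hv
      rcases openGraph_adj_cases huv with ⟨e, -⟩ | ⟨e, -⟩ | ⟨e, -⟩ | ⟨e, -⟩ <;>
        simp only [columnFlux, Prod.ext_iff] at e ⊢ <;> grind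
  have horiz : ∀ a b : ℤ, ¬ IsOpenAt ω ((b, a), false) →
      stepSum (columnFlux b (a + 1)) w = stepSum (columnFlux b a) w := by
    intro a b hab
    rw [stepSum_eq_add_sub (ψ := columnFlux b a) (fun _ => 0) w]
    · simp
    · intro u hu v hv huv
      rcases openGraph_adj_cases huv with ⟨e, ho⟩ | ⟨e, ho⟩ | ⟨e, -⟩ | ⟨e, -⟩
      · have : u ≠ (b, a) := fun h => hab (h ▸ ho)
        simp only [columnFlux, Prod.ext_iff, ne_eq] at e this ⊢
        grind
      · have : v ≠ (b, a) := fun h => hab (h ▸ ho)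
        simp only [columnFlux, Prod.ext_iff, ne_eq] at e this ⊢
        grind
      all_goals
        simp only [columnFlux, Prod.ext_iff] at e ⊢
        grind
  have vert : ∀ a b : ℤ, 0 ≤ b → b + 1 < n → ¬ IsOpenAt ω ((b + 1, a - 1), true) →
      stepSum (columnFlux (b + 1) a) w = stepSum (columnFlux b a) w := by
    intro a b hb hbn hab
    -- Shifting the ray sweeps column `b + 1` below height `a`. The walk starts and ends off this
    -- column, and the only vertical edge out of the swept part is closed, so inflow equals outflow.
    rw [stepSum_eq_add_sub (ψ := columnFlux b a)
      (fun u => if u.1 = b + 1 ∧ u.2 < a then -1 else 0) w]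
    · grind
    · intro u hu v hv huv
      rcases openGraph_adj_cases huv with ⟨e, ho⟩ | ⟨e, ho⟩ | ⟨e, ho⟩ | ⟨e, ho⟩
      · simp only [columnFlux, Prod.ext_iff] at e ⊢
        grind
      · simp only [columnFlux, Prod.ext_iff] at e ⊢
        grind
      · have : u ≠ (b + 1, a - 1) := fun h => hab (h ▸ ho)
        simp only [columnFlux, Prod.ext_iff, ne_eq] at e this ⊢
        grind
      · have : v ≠ (b + 1, a - 1) := fun h => hab (h ▸ ho)
        simp only [columnFlux, Prod.ext_iff, ne_eq] at e this ⊢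
        grind
  have hconst := eq_of_walk (fun p => stepSum (columnFlux p.2 p.1) w) w' (by
    rintro ⟨a, b⟩ hu ⟨c, d⟩ hv huv
    have hu := hw' _ hu
    have hv := hw' _ hv
    rcases openGraph_adj_cases huv with ⟨e, ho⟩ | ⟨e, ho⟩ | ⟨e, ho⟩ | ⟨e, ho⟩ <;>
      obtain ⟨rfl, rfl⟩ := Prod.mk.inj e
    · exact (horiz _ _ ((isOpenAt_dualConfig_horizontal _ _ _).1 ho)).symm
    · exact horiz _ _ ((isOpenAt_dualConfig_horizontal _ _ _).1 ho)
    · exact (vert _ _ (by grind) (by grind) ((isOpenAt_dualConfig_vertical _ _ _).1 ho)).symm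
    · exact vert _ _ (by grind) (by grind) ((isOpenAt_dualConfig_vertical _ _ _).1 ho))
  simp only [hx', hy', h0, h1 y'.2 (by grind) (by grind)] at hconst
  exact zero_ne_one hconst

/-! ### There is a crossing or a dual crossing -/

/-- The vertices joined to the left side by an open path inside `R(a, b)`. -/
def leftCluster (a b : ℤ) (ω : Config) : Set (ℤ × ℤ) :=
  {y | ∃ (x : ℤ × ℤ) (w : (openGraph ω).Walk x y), x.1 = 0 ∧ ∀ v ∈ w.support, v ∈ rect a b}

lemma mem_leftCluster_of_fst_eq_zero {a b : ℤ} {ω : Config} {x : ℤ × ℤ} (hx : x ∈ rect a b)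
    (h : x.1 = 0) : x ∈ leftCluster a b ω :=
  ⟨x, .nil, h, by simpa using hx⟩

lemma mem_leftCluster_of_adj {a b : ℤ} {ω : Config} {x y : ℤ × ℤ} (h : (openGraph ω).Adj x y)
    (hy : y ∈ rect a b) (hx : x ∈ leftCluster a b ω) : y ∈ leftCluster a b ω := by
  obtain ⟨z, w, hz, hw⟩ := hx
  refine ⟨z, w.concat h, hz, fun v hv => ?_⟩
  rw [SimpleGraph.Walk.support_concat] at hv
  grind

lemma mem_leftCluster_iff_of_adj {a b : ℤ} {ω : Config} {x y : ℤ × ℤ} (h : (openGraph ω).Adj x y)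
    (hx : x ∈ rect a b) (hy : y ∈ rect a b) : x ∈ leftCluster a b ω ↔ y ∈ leftCluster a b ω :=
  ⟨mem_leftCluster_of_adj h hy, mem_leftCluster_of_adj h.symm hx⟩

/-- Two potentials on a rectangle and on its dual whose gradients have disjoint supports cannot both
have a unit drop between opposite sides. -/
lemma not_disjoint_gradients {n : ℕ} {f h : ℕ → ℕ → ℤ}
    (f_left : ∀ j < n, f 0 j = 0) (f_right : ∀ j < n, f n j = 1)
    (h_bot : ∀ i < n, h i 0 = 0) (h_top : ∀ i < n, h i n = 1)
    (horiz : ∀ i < n, ∀ j < n, f (i + 1) j = f i j ∨ h i (j + 1) = h i j)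
    (vert : ∀ i, i + 1 < n → ∀ j, j + 1 < n →
      f (i + 1) (j + 1) = f (i + 1) j ∨ h (i + 1) (j + 1) = h i (j + 1)) : n = 0 := by
  have up : ∀ j < n, ∑ i ∈ Finset.range n, (f (i + 1) j - f i j) * h i (j + 1) =
      ∑ i ∈ Finset.range n, (f (i + 1) j - f i j) * h i j := fun j hj =>
    Finset.sum_congr rfl fun i hi => by
      rcases horiz i (Finset.mem_range.1 hi) j hj with e | e <;> simp [e]
  have across : ∀ j, j + 1 < n →
      ∑ i ∈ Finset.range n, (f (i + 1) (j + 1) - f i (j + 1)) * h i (j + 1) =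
      ∑ i ∈ Finset.range n, (f (i + 1) j - f i j) * h i (j + 1) := fun j hj => by
    rw [← sub_eq_zero, ← Finset.sum_sub_distrib]
    -- Summation by parts: `vert` allows `h i` to become `h (i - 1)` in the second product, and the
    -- sum telescopes. At `i = 0` the truncated `i - 1` is harmless because its factor vanishes by
    -- `f_left`.
    calc _ = ∑ i ∈ Finset.range n,
          ((f (i + 1) (j + 1) - f (i + 1) j) * h i (j + 1) -
            (f i (j + 1) - f i j) * h (i - 1) (j + 1)) :=
          Finset.sum_congr rfl fun i hi => by
            rcases i with _ | i
            · simp [f_left j (by omega), f_left (j + 1) hj, sub_mul]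
            · have := vert i (by simpa using hi) j hj
              simp only [Nat.add_sub_cancel]
              rcases this with e | e <;> rw [e] <;> ring
      _ = 0 := by
          have := Finset.sum_range_sub (fun i => (f i (j + 1) - f i j) * h (i - 1) (j + 1)) n
          simp only [Nat.add_sub_cancel] at this
          rw [this]
          simp [f_left j (by omega), f_left (j + 1) hj, f_right j (by omega), f_right (j + 1) hj]
  have zero : ∀ j < n, ∑ i ∈ Finset.range n, (f (i + 1) j - f i j) * h i j = 0 := by
    intro j
    induction j with
    | zero =>
      exact fun _ => Finset.sum_eq_zero fun i hi => by simp [h_bot i (Finset.mem_range.1 hi)]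
    | succ j ih =>
      intro hj
      rw [across j hj, up j (by omega), ih (by omega)]
  by_contra hn
  obtain ⟨m, rfl⟩ := Nat.exists_eq_succ_of_ne_zero hn
  have h1 := up m (by omega)
  rw [zero m (by omega), Finset.sum_congr rfl fun i hi => by
    rw [h_top i (Finset.mem_range.1 hi), mul_one], Finset.sum_range_sub (fun i => f i m),
    f_left m (by omega), f_right m (by omega)] at h1
  norm_num at h1

lemma dualConfig_mem_horizontalCrossing {n : ℕ} (hn : 1 ≤ n) {ω : Config}
    (hω : ω ∉ horizontalCrossing n (n - 1)) : dualConfig ω ∈ horizontalCrossing n (n - 1) := by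
  classical
  by_contra hω'
  have right : ∀ {η : Config}, η ∉ horizontalCrossing n (n - 1) → ∀ b : ℤ,
      ((n : ℤ), b) ∉ leftCluster n (n - 1) η := by
    rintro η hη b ⟨x, w, hx, hw⟩
    exact hη ⟨x, _, w, hx, rfl, hw⟩
  have mem : ∀ {a b : ℕ}, a ≤ n → b < n → ((a : ℤ), (b : ℤ)) ∈ rect n (n - 1) := by
    intro a b ha hb
    simp only [rect, Set.mem_prod, Set.mem_Icc]
    omega
  -- The potentials are indicators of the complements of the two left clusters. The swapped
  -- coordinates in `h` undo the reflection.
  have := not_disjoint_gradients (n := n)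
    (f := fun i j => if ((i : ℤ), (j : ℤ)) ∈ leftCluster n (n - 1) ω then 0 else 1)
    (h := fun i j => if ((j : ℤ), (i : ℤ)) ∈ leftCluster n (n - 1) (dualConfig ω) then 0 else 1)
    (fun j hj => if_pos (mem_leftCluster_of_fst_eq_zero (mem (by omega) hj) (by simp)))
    (fun j hj => if_neg (right hω _))
    (fun i hi => if_pos (mem_leftCluster_of_fst_eq_zero (mem (by omega) hi) (by simp)))
    (fun i hi => if_neg (right hω' _))
    (fun i hi j hj => by
      by_cases ho : IsOpenAt ω (((i : ℤ), (j : ℤ)), false)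
      · have := mem_leftCluster_iff_of_adj (openGraph_adj_right ho) (mem (by omega) hj)
          (by exact_mod_cast mem (a := i + 1) (by omega) hj)
        left
        simp [this]
      · have := mem_leftCluster_iff_of_adj
          (openGraph_adj_right ((isOpenAt_dualConfig_horizontal _ _ _).2 ho))
          (mem (by omega) hi) (by exact_mod_cast mem (a := j + 1) (by omega) hi)
        right
        simp [this])
    (fun i hi j hj => by
      by_cases ho : IsOpenAt ω (((i : ℤ) + 1, (j : ℤ)), true)
      · have := mem_leftCluster_iff_of_adj (a := n) (b := n - 1) (openGraph_adj_up ho)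
          (by exact_mod_cast mem (a := i + 1) (b := j) (by omega) (by omega))
          (by exact_mod_cast mem (a := i + 1) (b := j + 1) (by omega) (by omega))
        left
        simp [this]
      · have := mem_leftCluster_iff_of_adj (a := n) (b := n - 1)
          (openGraph_adj_up ((isOpenAt_dualConfig_vertical ω ((j : ℤ) + 1) i).2 (by simpa using ho)))
          (by exact_mod_cast mem (a := j + 1) (b := i) (by omega) (by omega))
          (by exact_mod_cast mem (a := j + 1) (b := i + 1) (by omega) (by omega))
        right
        simp [this])
  omega

/-! ### Measurability and invariance -/

lemma measurableSet_adj (x y : ℤ × ℤ) : MeasurableSet {ω : Config | (openGraph ω).Adj x y} := by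
  by_cases h : squareLattice.Adj x y
  · have : {ω : Config | (openGraph ω).Adj x y} =
        (fun ω : Config => ω ⟨s(x, y), h⟩) ⁻¹' {true} := by
      ext ω
      exact ⟨fun ⟨_, h'⟩ => h', fun h' => ⟨h, h'⟩⟩
    rw [this]
    exact measurable_pi_apply _ (measurableSet_singleton _)
  · convert MeasurableSet.empty
    ext ω
    simpa using fun h' : (openGraph ω).Adj x y => h h'.1

lemma measurableSet_walk_of_length (S : Set (ℤ × ℤ)) (k : ℕ) (x y : ℤ × ℤ) :
    MeasurableSet {ω : Config | ∃ w : (openGraph ω).Walk x y,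
      w.length = k ∧ ∀ v ∈ w.support, v ∈ S} := by
  induction k generalizing x with
  | zero =>
    convert MeasurableSet.const (x = y ∧ x ∈ S) using 3 with ω
    constructor
    · rintro ⟨w, hw, hS⟩
      exact ⟨SimpleGraph.Walk.eq_of_length_eq_zero hw, hS _ w.start_mem_support⟩
    · rintro ⟨rfl, hx⟩
      exact ⟨.nil, rfl, by simpa using hx⟩
  | succ k ih =>
    have : {ω : Config | ∃ w : (openGraph ω).Walk x y,
        w.length = k + 1 ∧ ∀ v ∈ w.support, v ∈ S} =
        ⋃ z, ({ω | (openGraph ω).Adj x z} ∩ {_ω | x ∈ S}) ∩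
          {ω : Config | ∃ w : (openGraph ω).Walk z y, w.length = k ∧ ∀ v ∈ w.support, v ∈ S} := by
      ext ω
      simp only [Set.mem_ofPred_eq, Set.mem_iUnion, Set.mem_inter_iff]
      constructor
      · rintro ⟨w, hk, hS⟩
        cases w with
        | nil => simp at hk
        | cons e p =>
          exact ⟨_, ⟨e, hS _ (by simp)⟩, p, by simpa using hk, fun v hv => hS v (by simp [hv])⟩
      · rintro ⟨z, ⟨e, hx⟩, p, hk, hS⟩
        exact ⟨.cons e p, by simpa using hk, by simpa using ⟨hx, fun a b hv => hS (a, b) hv⟩⟩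
    rw [this]
    exact .iUnion fun z => ((measurableSet_adj x z).inter (.const _)).inter (ih z)

lemma measurableSet_horizontalCrossing (a b : ℤ) : MeasurableSet (horizontalCrossing a b) := by
  have : horizontalCrossing a b = ⋃ (x : ℤ × ℤ) (y : ℤ × ℤ) (k : ℕ),
      {_ω | x.1 = 0 ∧ y.1 = a} ∩ {ω : Config | ∃ w : (openGraph ω).Walk x y,
        w.length = k ∧ ∀ v ∈ w.support, v ∈ rect a b} := by
    ext ω
    simp only [horizontalCrossing, Set.mem_ofPred_eq, Set.mem_iUnion, Set.mem_inter_iff]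
    constructor
    · rintro ⟨x, y, w, hx, hy, hw⟩
      exact ⟨x, y, _, ⟨hx, hy⟩, w, rfl, hw⟩
    · rintro ⟨x, y, k, ⟨hx, hy⟩, w, -, hw⟩
      exact ⟨x, y, w, hx, hy, hw⟩
  rw [this]
  exact .iUnion fun x => .iUnion fun y => .iUnion fun k =>
    (MeasurableSet.const _).inter (measurableSet_walk_of_length _ k x y)

lemma map_not_bernoulliMeasure_half {p : unitInterval} (hp : (p : ℝ) = 1 / 2) :
    (bernoulliMeasure true false p).map not = bernoulliMeasure true false p := by
  have hσ : unitInterval.symm p = p := Subtype.ext (by rw [unitInterval.coe_symm_eq, hp]; norm_num)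
  simp only [bernoulliMeasure_def, hσ]
  rw [Measure.map_add _ _ (by fun_prop), Measure.map_smul, Measure.map_smul,
    Measure.map_dirac, Measure.map_dirac, add_comm]
  rfl

/-- `dualConfig` is an injective reindexing of the i.i.d. coordinates followed by a flip of each,
and a fair coin is invariant under the flip. -/
lemma measurePreserving_dualConfig {p : unitInterval} (hp : (p : ℝ) = 1 / 2) :
    MeasurePreserving dualConfig (bernoulliPercolation p) (bernoulliPercolation p) := by
  refine ⟨by unfold dualConfig; fun_prop, ?_⟩
  have hflip := Measure.infinitePi_map_pi
    (μ := fun _ : squareLattice.edgeSet => bernoulliMeasure true false p)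
    (f := fun _ => not) fun _ => by fun_prop
  have hperm := Measure.map_infinitePi_infinitePi_of_inj
    (P := fun _ : squareLattice.edgeSet => bernoulliMeasure true false p) dualEdge_injective
  simp only [map_not_bernoulliMeasure_half hp] at hflip
  unfold bernoulliPercolation
  conv_rhs => rw [← hflip, ← hperm]
  rw [Measure.map_map (by fun_prop) (by fun_prop)]
  rfl

end SquarePercolation

theorem mainTheorem9 (n : ℕ) (hn : 1 ≤ n) :
    SquarePercolation.bernoulliPercolation ⟨1 / 2, by norm_num, by norm_num⟩
      (SquarePercolation.horizontalCrossing (n : ℤ) ((n : ℤ) - 1)) = 1 / 2 := by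
  open SquarePercolation in
  set μ := bernoulliPercolation ⟨1 / 2, by norm_num, by norm_num⟩ with hμ
  have : IsProbabilityMeasure μ := by rw [hμ, bernoulliPercolation]; infer_instance
  have hm := measurableSet_horizontalCrossing (n : ℤ) ((n : ℤ) - 1)
  have hdual : dualConfig ⁻¹' horizontalCrossing (n : ℤ) ((n : ℤ) - 1) =
      (horizontalCrossing (n : ℤ) ((n : ℤ) - 1))ᶜ := by
    ext ω
    exact ⟨fun h h' => dualConfig_notMem_horizontalCrossing h' h,
      dualConfig_mem_horizontalCrossing hn⟩
  have heq := (measurePreserving_dualConfig (p := ⟨1 / 2, by norm_num, by norm_num⟩) rfl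
    ).measure_preimage hm.nullMeasurableSet
  rw [hdual] at heq
  have hadd := measure_add_measure_compl (μ := μ) hm
  rw [heq, measure_univ, ← two_mul] at hadd
  rw [ENNReal.eq_div_iff (by norm_num) (by norm_num)]
  exact hadd
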